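/- Let $m \ge 1$ and let $\mathcal A=\bigoplus_{r\in\mathbb Z/m\mathbb Z}\mathcal A_r$ be a $\mathbb Z/m\mathbb Z$-graded Frobenius $\star$-algebra. That is, $\mathcal A$ is a finite-dimensional associative unital $\mathbb Z/m\mathbb Z$-graded $\mathbb C$-algebra with a conjugate-linear involutive anti-automorphism $\star$ such that $(\mathcal A_r)^\star\subseteq\mathcal A_{-r}$ for all $r$, together with a linear functional $\lambda_0:\mathcal A_0\to\mathbb C$ satisfying $\lambda_0(ab)=\lambda_0(ba)$ for all $a,b\in\mathcal A_0$, such that, for the extension $\lambda$ of $\lambda_0$ to $\mathcal A$ by zero on $\mathcal A_r$, $r\neq 0$, the form $\langle a,b\rangle=\lambda(ab^\star)$ is a positive definite Hermitian form on $\mathcal A$. A twisted class functional on $\mathcal A_1$ is a linear functional $\gamma:\mathcal A_1\to\mathbb C$ with $\gamma(ax)=\gamma(xa)$ for all $a\in\mathcal A_0$, $x\in\mathcal A_1$. For a left $\mathcal A_0$-module $M$, grade $\mathcal A\otimes_{\mathcal A_0}M$ by letting its $r$-component be the image of $\mathcal A_r\otimes M$, and let $\mathcal A\,\overline\otimes\,M$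 be the quotient of $\mathcal A\otimes_{\mathcal A_0}M$ by its largest graded $\mathcal A$-submodule whose degree-$0$ component is zero. Let $M^{(r)}$ be the $r$-component of $\mathcal A\,\overline\otimes\,M$, an $\mathcal A_0$-module. Let $\mathrm{Sim}(\mathcal A_0)$ be the set of isomorphism classes of simple left $\mathcal A_0$-modules and $\mathrm{Sim}(\mathcal A_0)^{\mathbb Z/m\mathbb Z}$ the subset of the classes of those $M$ with $M^{(r)}\cong M$ as $\mathcal A_0$-modules for all $r\in\mathbb Z/m\mathbb Z$. Then $\mathrm{Sim}(\mathcal A_0)^{\mathbb Z/m\mathbb Z}$ is finite, and the dimension over $\mathbb C$ of the space of twisted class functionals on $\mathcal A_1$ equals the cardinality of $\mathrm{Sim}(\mathcal A_0)^{\mathbb Z/m\mathbb Z}$. -/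

import Mathlib

open scoped TensorProduct DirectSum

universe u v

noncomputable section

namespace TwistedClass

section Graded

variable {m : ℕ} {A : Type u} [Ring A] [Algebra ℂ A]
  (𝒜 : ZMod m → Submodule ℂ A) [GradedAlgebra 𝒜]

/-- The degree-zero component `A₀`, as a subalgebra of `A`. -/
abbrev zeroPart : Subalgebra ℂ A := SetLike.GradeZero.subalgebra 𝒜

/-- The projection `A → A₀` along the other homogeneous components. -/
def projZero : A →ₗ[ℂ] zeroPart 𝒜 :=
  (GradedAlgebra.proj 𝒜 0).codRestrict (Subalgebra.toSubmodule (zeroPart 𝒜))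
    (fun a => (DirectSum.decompose 𝒜 a 0).2)

/-- The extension `lam` of a functional `lam₀` on `A₀` to `A` by zero on `A_r`, `r ≠ 0`. -/
def extendByZero (lam₀ : zeroPart 𝒜 →ₗ[ℂ] ℂ) : A →ₗ[ℂ] ℂ := lam₀ ∘ₗ projZero 𝒜

/-- `(A, lam₀, star)` is a `ℤ/m`-graded Frobenius star-algebra. That `A` is an associative unital
finite-dimensional graded algebra and that `star` is a conjugate-linear involutive
anti-automorphism is expressed by the type classes `Ring`, `Algebra ℂ`, `FiniteDimensional ℂ`,
`GradedAlgebra`, `StarRing`, `StarModule ℂ`; the remaining axioms are listed here. -/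
structure IsGradedFrobeniusStar [StarRing A] [StarModule ℂ A] [FiniteDimensional ℂ A]
    (lam₀ : zeroPart 𝒜 →ₗ[ℂ] ℂ) : Prop where
  /-- `lam₀` is a class functional on `A₀`. -/
  class_functional : ∀ a b : zeroPart 𝒜, lam₀ (a * b) = lam₀ (b * a)
  /-- `(A_r)^* ⊆ A_{-r}`. -/
  star_mem : ∀ (r : ZMod m) (a : A), a ∈ 𝒜 r → star a ∈ 𝒜 (-r)
  /-- The form `⟨a, b⟩ = lam (a b^*)` is Hermitian. -/
  hermitian : ∀ a b : A, extendByZero 𝒜 lam₀ (a * star b) =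
    starRingEnd ℂ (extendByZero 𝒜 lam₀ (b * star a))
  /-- The form `⟨a, b⟩ = lam (a b^*)` is positive definite. -/
  pos_def : ∀ a : A, a ≠ 0 → 0 < (extendByZero 𝒜 lam₀ (a * star a)).re

lemma zeroPart_mul_mem {r : ZMod m} (a : zeroPart 𝒜) (x : 𝒜 r) : (a : A) * (x : A) ∈ 𝒜 r := by
  simpa using SetLike.mul_mem_graded (A := 𝒜) a.2 x.2

lemma mul_zeroPart_mem {r : ZMod m} (x : 𝒜 r) (a : zeroPart 𝒜) : (x : A) * (a : A) ∈ 𝒜 r := by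
  simpa using SetLike.mul_mem_graded (A := 𝒜) x.2 a.2

/-- The space of twisted class functionals on the `A₀`-bimodule `A_r`: linear functionals `γ` on
`A_r` with `γ (a x) = γ (x a)` for all `a ∈ A₀` and `x ∈ A_r`. -/
def twistedClassFunctionals (r : ZMod m) : Submodule ℂ (Module.Dual ℂ (𝒜 r)) where
  carrier := {γ | ∀ (a : zeroPart 𝒜) (x : 𝒜 r),
    γ ⟨(a : A) * (x : A), zeroPart_mul_mem 𝒜 a x⟩ = γ ⟨(x : A) * (a : A), mul_zeroPart_mem 𝒜 x a⟩}
  add_mem' := by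
    intro γ δ hγ hδ a x
    simp only [LinearMap.add_apply]
    rw [hγ a x, hδ a x]
  zero_mem' := by
    intro a x
    rfl
  smul_mem' := by
    intro c γ hγ a x
    simp only [LinearMap.smul_apply]
    rw [hγ a x]

variable (M : Type v) [AddCommGroup M] [Module (zeroPart 𝒜) M]

/-- The relations `(a b) ⊗ x = a ⊗ (b x)`, `b ∈ A₀`, that cut `A ⊗_{A₀} M` out of `A ⊗_ℤ M`. -/
def balancingRelations : Submodule A (A ⊗[ℤ] M) :=
  Submodule.span A {t | ∃ (a : A) (b : zeroPart 𝒜) (x : M),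
    t = (a * (b : A)) ⊗ₜ[ℤ] x - a ⊗ₜ[ℤ] (b • x)}

/-- The left `A`-module `A ⊗_{A₀} M` (over the not necessarily commutative ring `A₀`). -/
abbrev TensorInd : Type (max u v) := (A ⊗[ℤ] M) ⧸ balancingRelations 𝒜 M

/-- The homogeneous component `(A ⊗_{A₀} M)_r`, the image of `A_r ⊗ M`. -/
def tensorComponent (r : ZMod m) : Submodule (zeroPart 𝒜) (TensorInd 𝒜 M) :=
  Submodule.span (zeroPart 𝒜) {t | ∃ (a : 𝒜 r) (x : M),
    t = (balancingRelations 𝒜 M).mkQ ((a : A) ⊗ₜ[ℤ] x)}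

/-- An `A`-submodule `U` of `A ⊗_{A₀} M` is graded if it is the sum of the `U ∩ (A ⊗_{A₀} M)_r`. -/
def IsGradedSubmodule (U : Submodule A (TensorInd 𝒜 M)) : Prop :=
  U.restrictScalars (zeroPart 𝒜) =
    ⨆ r : ZMod m, U.restrictScalars (zeroPart 𝒜) ⊓ tensorComponent 𝒜 M r

/-- A submodule is null if its degree-zero part vanishes. -/
def IsNull (U : Submodule A (TensorInd 𝒜 M)) : Prop :=
  U.restrictScalars (zeroPart 𝒜) ⊓ tensorComponent 𝒜 M 0 = ⊥

/-- The null socle: the largest null graded submodule, that is, the sum of all of them. -/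
def nullSocle : Submodule A (TensorInd 𝒜 M) :=
  sSup {U | IsGradedSubmodule 𝒜 M U ∧ IsNull 𝒜 M U}

/-- The induced module: the quotient of `A ⊗_{A₀} M` by its null socle. -/
abbrev Induced : Type (max u v) := TensorInd 𝒜 M ⧸ nullSocle 𝒜 M

/-- The partial action of `ℤ/m` on simple `A₀`-modules: `M^r` is the `r`-component of the
induced module (it may be zero). -/
def conjugate (r : ZMod m) : Submodule (zeroPart 𝒜) (Induced 𝒜 M) :=
  (tensorComponent 𝒜 M r).map ((nullSocle 𝒜 M).mkQ.restrictScalars (zeroPart 𝒜))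

/-- `M` is `ℤ/m`-invariant: `M^r ≅ M` as `A₀`-modules for all `r ∈ ℤ/m`. -/
def IsInvariant : Prop :=
  ∀ r : ZMod m, Nonempty (conjugate 𝒜 M r ≃ₗ[zeroPart 𝒜] M)

end Graded

section Sim

variable (R : Type u) [Ring R]

/-- Simple left `R`-modules, up to isomorphism as a relation. Every simple `R`-module is a quotient
of `R`, so the universe of `R` contains a copy of each of them. -/
instance simpleSetoid : Setoid {M : ModuleCat.{u} R // IsSimpleModule R M} where
  r M N := Nonempty (M.1 ≃ₗ[R] N.1)
  iseqv :=
    { refl := fun M => ⟨LinearEquiv.refl R M.1⟩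
      symm := fun ⟨e⟩ => ⟨e.symm⟩
      trans := fun ⟨e⟩ ⟨f⟩ => ⟨e.trans f⟩ }

/-- `Sim R`: the set of isomorphism classes of simple left `R`-modules. -/
def Sim : Type (u + 1) := Quotient (simpleSetoid R)

end Sim

/-- `Sim(A₀)^{ℤ/m}`: the set of classes in `Sim(A₀)` of `ℤ/m`-invariant simple modules. -/
def invariantSim {m : ℕ} {A : Type u} [Ring A] [Algebra ℂ A]
    (𝒜 : ZMod m → Submodule ℂ A) [GradedAlgebra 𝒜] : Set (Sim (zeroPart 𝒜)) :=
  {c | ∃ M : {M : ModuleCat.{u} (zeroPart 𝒜) // IsSimpleModule (zeroPart 𝒜) M},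
    Quotient.mk (simpleSetoid (zeroPart 𝒜)) M = c ∧ IsInvariant 𝒜 M.1}

end TwistedClass

end

/-!
Positivity makes `star` proper on `A₀` (`a a* = 0` only for `a = 0`), so `A₀` is a product of matrix
algebras, and its simple modules correspond to the primitive central idempotents `e`.

The pairing `(x, w) ↦ lam (x w)` identifies the twisted class functionals on `A_r` with the
centralizer `Z_{-r}` of `A₀` in `A_{-r}`. For `w ∈ Z_s` both `e w w*` and `e w* w` are the same
multiple of `e`, non-zero if `e w ≠ 0`; so `w` is then invertible on the block of `e`, and `e Z_s`
is at most one-dimensional. Hence `dim Z_s` counts the `e` with `e Z_s ≠ 0`, and for fixed `e` these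
degrees `s` form a subgroup of `ℤ/m`.

This subgroup is the stabilizer of the simple module `M` belonging to `e`. If `w ∈ Z_s` is
invertible on the block of `e`, then `x ↦ w ⊗ x` is an isomorphism `M ≅ M^s`. Conversely, if
`M^s ≅ M`, then `e A_s e ≠ 0`, and averaging over matrix units turns a non-zero element of `e A_s e`
into an element of `Z_s` not killed by `e`.
-/

noncomputable section

namespace TwistedClass

section ProperInvolution

lemma eq_zero_of_isNilpotent_of_star_eq {R : Type*} [Ring R] [StarRing R]
    (hR : ∀ a : R, a * star a = 0 → a = 0) {a : R} (ha : IsNilpotent a) (hstar : star a = a) :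
    a = 0 := by
  obtain ⟨n, hn⟩ := ha
  have hpow : ∀ k, a ^ 2 ^ k = 0 → a = 0 := by
    intro k
    induction k with
    | zero => simp
    | succ k ih => exact fun h => ih (hR _ (by rwa [star_pow, hstar, ← pow_two, ← pow_mul]))
  exact hpow n (pow_eq_zero_of_le n.lt_two_pow_self.le hn)

lemma isSemisimpleRing_of_mul_star_eq_zero {R : Type*} [Ring R] [IsArtinianRing R] [StarRing R]
    (hR : ∀ a : R, a * star a = 0 → a = 0) : IsSemisimpleRing R := by
  rw [IsArtinianRing.isSemisimpleRing_iff_jacobson, eq_bot_iff]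
  intro a ha
  have hmem : a * star a ∈ Ring.jacobson R := (Ring.jacobson R).mul_mem_right _ ha
  obtain ⟨n, hn⟩ := IsSemiprimaryRing.isNilpotent (R := R)
  have hnil : IsNilpotent (a * star a) :=
    ⟨n, by simpa [hn] using Ideal.pow_mem_pow hmem n⟩
  exact hR a (eq_zero_of_isNilpotent_of_star_eq hR hnil (by simp))

end ProperInvolution

section Idempotents

/-- A central idempotent `e` of an `F`-algebra is *split primitive* if it is non-zero and cuts out
of the center only the scalar multiples of `e`. Over an algebraically closed field these are the
identities of the simple factors of a semisimple algebra. -/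
structure IsSplitPrimitive (F : Type*) {R : Type*} [CommSemiring F] [Ring R] [Algebra F R]
    (e : R) : Prop where
  ne_zero : e ≠ 0
  isIdempotentElem : IsIdempotentElem e
  mem_center : e ∈ Subalgebra.center F R
  exists_mul_eq_smul : ∀ z ∈ Subalgebra.center F R, ∃ c : F, e * z = c • e

lemma finrank_eq_ncard_of_completeOrthogonalIdempotents {F V ι : Type*} [Field F] [AddCommGroup V]
    [Module F V] [FiniteDimensional F V] [Fintype ι] {P : ι → Module.End F V}
    (hP : CompleteOrthogonalIdempotents P)
    (hrank : ∀ i, Module.finrank F (LinearMap.range (P i)) ≤ 1) :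
    Module.finrank F V = {i | P i ≠ 0}.ncard := by
  classical
  have hsum (v : V) : ∑ i, P i v = v := by
    rw [← LinearMap.sum_apply, hP.complete, Module.End.one_apply]
  let φ : V →ₗ[F] ∀ i, LinearMap.range (P i) := LinearMap.pi fun i => (P i).rangeRestrict
  have hinj : Function.Injective φ := by
    intro v w h
    rw [← hsum v, ← hsum w]
    exact Finset.sum_congr rfl fun i _ => congrArg Subtype.val (congrFun h i)
  have hsurj : Function.Surjective φ := by
    intro y
    choose x hx using fun i => (y i).2
    refine ⟨∑ i, P i (x i), funext fun i => Subtype.ext ?_⟩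
    have hPP (j : ι) : P i (P j (x j)) = if i = j then P i (x i) else 0 := by
      rw [← Module.End.mul_apply, hP.mul_eq]
      split_ifs with hij
      · rw [hij]
      · rfl
    change P i (∑ j, P j (x j)) = y i
    rw [map_sum]
    simp only [hPP, Finset.sum_ite_eq, Finset.mem_univ, if_true]
    exact hx i
  have hfinrank (i : ι) :
      Module.finrank F (LinearMap.range (P i)) = if P i ≠ 0 then 1 else 0 := by
    split_ifs with h
    · exact le_antisymm (hrank i)
        (Submodule.one_le_finrank_iff.2 (mt LinearMap.range_eq_bot.1 h))
    · rw [not_not.1 h, LinearMap.range_zero, finrank_bot]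
  rw [(LinearEquiv.ofBijective φ ⟨hinj, hsurj⟩).finrank_eq, Module.finrank_pi_fintype]
  simp only [hfinrank, Finset.sum_boole, Nat.cast_id, Set.ncard_eq_toFinset_card']
  simp

lemma exists_forall_smul_eq_self {R M ι : Type*} [Ring R] [AddCommGroup M] [Module R M]
    [IsSimpleModule R M] [Fintype ι] {e : ι → R} (he : CompleteOrthogonalIdempotents e)
    (hcomm : ∀ i x, e i * x = x * e i) : ∃ i, ∀ x : M, e i • x = x := by
  have := IsSimpleModule.nontrivial R M
  obtain ⟨x, hx⟩ := exists_ne (0 : M)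
  obtain ⟨i, hi⟩ : ∃ i, e i • x ≠ 0 := by
    by_contra! h
    rw [← one_smul R x, ← he.complete, Finset.sum_smul] at hx
    exact hx (Finset.sum_eq_zero fun i _ => h i)
  refine ⟨i, fun y => ?_⟩
  obtain ⟨r, rfl⟩ := IsSimpleModule.toSpanSingleton_surjective R hi y
  rw [LinearMap.toSpanSingleton_apply, smul_smul, smul_smul, hcomm,
    mul_assoc, (he.idem i).eq, mul_smul]

end Idempotents

section Blocks

variable {F R ι : Type*} [Field F] [Ring R] [Algebra F R] [DecidableEq ι] {n : ι → Type*}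
  [∀ i, Fintype (n i)] [∀ i, DecidableEq (n i)] (f : R ≃ₐ[F] ∀ i, Matrix (n i) (n i) F)

/-- The identity of the `i`-th simple factor, under a Wedderburn decomposition `f`. -/
def blockIdempotent (i : ι) : R := f.symm (Pi.single i 1)

/-- The matrix unit in row `a` and column `b` of the `i`-th simple factor, under a Wedderburn
decomposition `f`. -/
def blockUnit (i : ι) (a b : n i) : R := f.symm (Pi.single i (Matrix.single a b 1))

lemma completeOrthogonalIdempotents_blockIdempotent [Fintype ι] :
    CompleteOrthogonalIdempotents (blockIdempotent f) :=
  (CompleteOrthogonalIdempotents.single fun i => Matrix (n i) (n i) F).map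
    (f.symm : (∀ i, Matrix (n i) (n i) F) →+* R)

lemma isIdempotentElem_blockIdempotent (i : ι) : IsIdempotentElem (blockIdempotent f i) := by
  rw [IsIdempotentElem, blockIdempotent, ← map_mul, ← Pi.single_mul, one_mul]

lemma apply_blockIdempotent_mul (i : ι) (x : R) :
    f (blockIdempotent f i * x) = Pi.single i (f x i) := by
  rw [map_mul, blockIdempotent, f.apply_symm_apply, ← Pi.single_mul_left, one_mul]

lemma blockIdempotent_mul_comm (i : ι) (x : R) :
    blockIdempotent f i * x = x * blockIdempotent f i := by
  apply f.injective
  rw [apply_blockIdempotent_mul, map_mul, blockIdempotent, f.apply_symm_apply,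
    ← Pi.single_mul_right, mul_one]

lemma sum_blockUnit_self (i : ι) : ∑ a, blockUnit f i a a = blockIdempotent f i := by
  simp only [blockUnit, blockIdempotent, ← map_sum]
  rw [← Matrix.sum_single_one]
  congr 1
  exact (map_sum (AddMonoidHom.single (fun i => Matrix (n i) (n i) F) i) _ _).symm

lemma blockUnit_mul_blockUnit (i : ι) (a b c : n i) :
    blockUnit f i a b * blockUnit f i b c = blockUnit f i a c := by
  simp [blockUnit, ← map_mul, ← Pi.single_mul]

lemma blockUnit_mul_blockUnit_of_ne (i : ι) (a d : n i) {b c : n i} (h : b ≠ c) :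
    blockUnit f i a b * blockUnit f i c d = 0 := by
  simp [blockUnit, ← map_mul, ← Pi.single_mul, h]

lemma blockUnit_mul_mul_blockUnit (i : ι) (a p q b : n i) (x : R) :
    blockUnit f i a p * x * blockUnit f i q b = f x i p q • blockUnit f i a b := by
  apply f.injective
  simp only [blockUnit, map_mul, map_smul, f.apply_symm_apply, ← Pi.single_mul_left,
    ← Pi.single_mul_right, Pi.single_eq_same, Matrix.single_mul_mul_single, ← Pi.single_smul]
  simp

lemma blockIdempotent_mul_blockUnit (i : ι) (a b : n i) :
    blockIdempotent f i * blockUnit f i a b = blockUnit f i a b := by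
  simp [blockIdempotent, blockUnit, ← map_mul, ← Pi.single_mul]

lemma mul_blockUnit (i : ι) (a b : n i) (x : R) :
    x * blockUnit f i a b = ∑ k, f x i k a • blockUnit f i k b := by
  simp only [← blockUnit_mul_mul_blockUnit, ← Finset.sum_mul, sum_blockUnit_self]
  rw [blockIdempotent_mul_comm, mul_assoc, blockIdempotent_mul_blockUnit]

lemma blockUnit_mul (i : ι) (a b : n i) (x : R) :
    blockUnit f i a b * x = ∑ k, f x i b k • blockUnit f i a k := by
  simp only [← blockUnit_mul_mul_blockUnit, ← Finset.mul_sum, sum_blockUnit_self]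
  rw [← blockIdempotent_mul_comm, ← mul_assoc, blockIdempotent_mul_blockUnit]

lemma blockIdempotent_ne_zero (i : ι) [Nonempty (n i)] : blockIdempotent f i ≠ 0 := by
  rw [blockIdempotent, ne_eq, map_eq_zero_iff _ f.symm.injective, Pi.single_eq_zero_iff]
  exact one_ne_zero

lemma isSplitPrimitive_blockIdempotent (i : ι) [Nonempty (n i)] :
    IsSplitPrimitive F (blockIdempotent f i) where
  ne_zero := blockIdempotent_ne_zero f i
  isIdempotentElem := isIdempotentElem_blockIdempotent f i
  mem_center := Subalgebra.mem_center_iff.2 fun x => (blockIdempotent_mul_comm f i x).symm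
  exists_mul_eq_smul z hz := by
    obtain ⟨p⟩ := ‹Nonempty (n i)›
    refine ⟨f z i p p, ?_⟩
    rw [← sum_blockUnit_self, Finset.sum_mul, Finset.smul_sum]
    refine Finset.sum_congr rfl fun a _ => ?_
    calc blockUnit f i a a * z
        = blockUnit f i a p * (blockUnit f i p a * z) := by
          rw [← mul_assoc, blockUnit_mul_blockUnit]
      _ = blockUnit f i a p * z * blockUnit f i p a := by
          rw [Subalgebra.mem_center_iff.1 hz, mul_assoc]
      _ = f z i p p • blockUnit f i a a := blockUnit_mul_mul_blockUnit f i a p p a z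

section Modules

variable {M N : Type*} [AddCommGroup M] [Module R M] [AddCommGroup N] [Module R N] {i : ι}

lemma exists_smul_ne_zero_of_blockIdempotent [Nontrivial M]
    (hM : ∀ x : M, blockIdempotent f i • x = x) {s : R} (hs : blockIdempotent f i * s ≠ 0) :
    ∃ x : M, s • x ≠ 0 := by
  by_contra! hsM
  obtain ⟨p, q, hpq⟩ : ∃ p q, f s i p q ≠ 0 := by
    by_contra! h
    apply hs
    rw [← map_eq_zero_iff f f.injective, apply_blockIdempotent_mul, Pi.single_eq_zero_iff]
    exact Matrix.ext h
  obtain ⟨x, hx⟩ := exists_ne (0 : M)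
  rw [← hM x, ← sum_blockUnit_self, Finset.sum_smul] at hx
  refine hx (Finset.sum_eq_zero fun a _ => ?_)
  have hunit : blockUnit f i a a =
      ((f s i p q)⁻¹ • blockUnit f i a p) * s * blockUnit f i q a := by
    rw [smul_mul_assoc, smul_mul_assoc, blockUnit_mul_mul_blockUnit, inv_smul_smul₀ hpq]
  rw [hunit, mul_smul, mul_smul, hsM, smul_zero]

lemma nonempty_linearEquiv_of_blockIdempotent [Finite ι] [IsSimpleModule R M] [IsSimpleModule R N]
    (hM : ∀ x : M, blockIdempotent f i • x = x) (hN : ∀ x : N, blockIdempotent f i • x = x) :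
    Nonempty (M ≃ₗ[R] N) := by
  have : IsSemisimpleRing R := f.symm.toRingEquiv.isSemisimpleRing
  have := IsSimpleModule.nontrivial R N
  obtain ⟨I, ⟨g⟩⟩ := IsSemisimpleRing.exists_linearEquiv_ideal_of_isSimpleModule R M
  have : IsSimpleModule R I := .congr g.symm
  have := IsSimpleModule.nontrivial R I
  obtain ⟨s, hs⟩ := exists_ne (0 : I)
  have hes : blockIdempotent f i * (s : R) = s := by
    have h := congrArg g (hM (g.symm s))
    rw [map_smul, g.apply_symm_apply] at h
    exact congrArg Subtype.val h
  obtain ⟨x, hx⟩ := exists_smul_ne_zero_of_blockIdempotent f hN (s := (s : R))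
    (by rwa [hes, ne_eq, ZeroMemClass.coe_eq_zero])
  let φ : I →ₗ[R] N := (LinearMap.toSpanSingleton R N x).domRestrict I
  have hφ : φ ≠ 0 := fun h => hx (LinearMap.congr_fun h s)
  exact ⟨g.trans (.ofBijective φ (LinearMap.bijective_of_ne_zero hφ))⟩

lemma exists_isSimpleModule_of_blockIdempotent [Finite ι] (i : ι) [Nonempty (n i)] :
    ∃ I : Submodule R R, IsSimpleModule R I ∧ ∀ x : I, blockIdempotent f i • x = x := by
  have : IsSemisimpleRing R := f.symm.toRingEquiv.isSemisimpleRing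
  have hspan : Submodule.span R {blockIdempotent f i} ≠ ⊥ := by
    simpa using blockIdempotent_ne_zero f i
  obtain ⟨I, hI, hle⟩ := (IsAtomic.eq_bot_or_exists_atom_le _).resolve_left hspan
  refine ⟨I, isSimpleModule_iff_isAtom.2 hI, fun ⟨x, hx⟩ => Subtype.ext ?_⟩
  obtain ⟨r, rfl⟩ := Submodule.mem_span_singleton.1 (hle hx)
  change blockIdempotent f i * (r * blockIdempotent f i) = r * blockIdempotent f i
  rw [blockIdempotent_mul_comm, mul_assoc,
    (isIdempotentElem_blockIdempotent f i).eq]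

end Modules

lemma exists_equiv_sim {R : Type u} [Ring R] [Algebra F R] [Finite ι] [∀ i, Nonempty (n i)]
    (f : R ≃ₐ[F] ∀ i, Matrix (n i) (n i) F) :
    ∃ S : ι ≃ Sim R, ∀ i (M : {M : ModuleCat.{u} R // IsSimpleModule R M}),
      S i = Quotient.mk (simpleSetoid R) M ↔ ∀ x : M.1, blockIdempotent f i • x = x := by
  cases nonempty_fintype ι
  choose I hI hIe using fun i => exists_isSimpleModule_of_blockIdempotent f i
  let S (i : ι) : Sim R := Quotient.mk (simpleSetoid R) ⟨ModuleCat.of R (I i), hI i⟩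
  have hS (i : ι) (M : {M : ModuleCat.{u} R // IsSimpleModule R M}) :
      S i = Quotient.mk (simpleSetoid R) M ↔ ∀ x : M.1, blockIdempotent f i • x = x := by
    have := M.2
    constructor
    · intro h x
      obtain ⟨g⟩ := Quotient.exact h
      obtain ⟨y, rfl⟩ := g.surjective x
      rw [← map_smul]
      exact congrArg g (hIe i y)
    · exact fun h => Quotient.sound (nonempty_linearEquiv_of_blockIdempotent f (hIe i) h)
  have he := completeOrthogonalIdempotents_blockIdempotent f
  refine ⟨.ofBijective S ⟨fun i j hij => ?_, fun c => ?_⟩, hS⟩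
  · by_contra hne
    have := IsSimpleModule.nontrivial R (I j)
    obtain ⟨x, hx⟩ := exists_ne (0 : I j)
    have hix : blockIdempotent f i • x = x := (hS i ⟨ModuleCat.of R (I j), hI j⟩).1 hij x
    rw [← hix, ← hIe j x, smul_smul, he.ortho hne, zero_smul] at hx
    exact hx rfl
  · obtain ⟨M, rfl⟩ := Quotient.exists_rep c
    have := M.2
    obtain ⟨i, hi⟩ := exists_forall_smul_eq_self (M := M.1) he (blockIdempotent_mul_comm f)
    exact ⟨i, (hS i M).2 hi⟩

section Centralizer

variable {A : Type*} [Ring A] [Algebra F A] {B : Subalgebra F A}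
  (g : B ≃ₐ[F] ∀ i, Matrix (n i) (n i) F)

/-- The average `∑ₖ E_{k p} x E_{q k}` over a simple factor of `B`, which commutes with `B`. -/
def blockAverage (i : ι) (p q : n i) (x : A) : A :=
  ∑ k, ((blockUnit g i k p : B) : A) * x * ((blockUnit g i q k : B) : A)

lemma mul_blockAverage_comm (i : ι) (p q : n i) (x : A) (b : B) :
    (b : A) * blockAverage g i p q x = blockAverage g i p q x * b := by
  have hleft (k : n i) : (b : A) * (blockUnit g i k p : B) =
      ∑ l, g b i l k • ((blockUnit g i l p : B) : A) := by
    simpa using congrArg B.val (mul_blockUnit g i k p b)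
  have hright (k : n i) : ((blockUnit g i q k : B) : A) * b =
      ∑ l, g b i k l • ((blockUnit g i q l : B) : A) := by
    simpa using congrArg B.val (blockUnit_mul g i q k b)
  simp only [blockAverage, Finset.mul_sum, Finset.sum_mul, mul_assoc, hright]
  simp only [← mul_assoc, hleft, Finset.sum_mul, smul_mul_assoc, mul_smul_comm]
  exact Finset.sum_comm

lemma blockUnit_mul_blockAverage (i : ι) (p q : n i) (x : A) :
    ((blockUnit g i p q : B) : A) * blockAverage g i p q x =
      ((blockUnit g i p p : B) : A) * x * ((blockUnit g i q q : B) : A) := by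
  rw [blockAverage, Finset.mul_sum, Finset.sum_eq_single q]
  · rw [← mul_assoc, ← mul_assoc, ← MulMemClass.coe_mul, blockUnit_mul_blockUnit]
  · intro k _ hk
    rw [← mul_assoc, ← mul_assoc, ← MulMemClass.coe_mul,
      blockUnit_mul_blockUnit_of_ne g i p p hk.symm, ZeroMemClass.coe_zero, zero_mul, zero_mul]
  · simp

lemma exists_mul_blockAverage_ne_zero {i : ι} {x : A}
    (hx : ((blockIdempotent g i : B) : A) * x * (blockIdempotent g i : B) ≠ 0) :
    ∃ p q, ((blockIdempotent g i : B) : A) * blockAverage g i p q x ≠ 0 := by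
  by_contra! h
  have hunit (p q : n i) :
      ((blockUnit g i p p : B) : A) * x * ((blockUnit g i q q : B) : A) = 0 := by
    rw [← blockUnit_mul_blockAverage, ← blockIdempotent_mul_blockUnit, blockIdempotent_mul_comm,
      MulMemClass.coe_mul, mul_assoc, h, mul_zero]
  apply hx
  simp only [← sum_blockUnit_self, AddSubmonoidClass.coe_finsetSum, Finset.sum_mul,
    Finset.mul_sum, hunit, Finset.sum_const_zero]

end Centralizer

end Blocks

section GradedCentralizer

variable {m : ℕ} {A : Type u} [Ring A] [Algebra ℂ A] (𝒜 : ZMod m → Submodule ℂ A)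

/-- The elements of degree `r` that commute with the degree-zero part of a graded algebra. -/
def gradedCentralizer (r : ZMod m) : Submodule ℂ A :=
  𝒜 r ⊓ Subalgebra.toSubmodule (Subalgebra.centralizer ℂ (𝒜 0 : Set A))

variable {𝒜}

lemma mem_gradedCentralizer_iff {r : ZMod m} {w : A} :
    w ∈ gradedCentralizer 𝒜 r ↔ w ∈ 𝒜 r ∧ ∀ a ∈ 𝒜 0, a * w = w * a := by
  simp [gradedCentralizer, Subalgebra.mem_centralizer_iff]

variable [GradedAlgebra 𝒜] {r s : ZMod m} {z w : A} {e : zeroPart 𝒜}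

lemma coe_mul_comm_of_mem_gradedCentralizer (hw : w ∈ gradedCentralizer 𝒜 r) (b : zeroPart 𝒜) :
    (b : A) * w = w * b :=
  (mem_gradedCentralizer_iff.1 hw).2 b b.2

lemma mul_mem_gradedCentralizer (hz : z ∈ gradedCentralizer 𝒜 r)
    (hw : w ∈ gradedCentralizer 𝒜 s) : z * w ∈ gradedCentralizer 𝒜 (r + s) :=
  ⟨SetLike.mul_mem_graded hz.1 hw.1, (Subalgebra.centralizer ℂ (𝒜 0 : Set A)).mul_mem hz.2 hw.2⟩

lemma mem_center_of_mem_gradedCentralizer_zero (hz : z ∈ gradedCentralizer 𝒜 0) :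
    (⟨z, hz.1⟩ : zeroPart 𝒜) ∈ Subalgebra.center ℂ (zeroPart 𝒜) :=
  Subalgebra.mem_center_iff.2 fun b =>
    Subtype.ext (coe_mul_comm_of_mem_gradedCentralizer hz b)

lemma coe_mem_gradedCentralizer_zero (he : e ∈ Subalgebra.center ℂ (zeroPart 𝒜)) :
    (e : A) ∈ gradedCentralizer 𝒜 0 :=
  mem_gradedCentralizer_iff.2 ⟨e.2, fun a ha =>
    congrArg Subtype.val (Subalgebra.mem_center_iff.1 he ⟨a, ha⟩)⟩

lemma coe_mul_mem_gradedCentralizer (he : e ∈ Subalgebra.center ℂ (zeroPart 𝒜))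
    (hw : w ∈ gradedCentralizer 𝒜 r) : (e : A) * w ∈ gradedCentralizer 𝒜 r := by
  simpa using mul_mem_gradedCentralizer (coe_mem_gradedCentralizer_zero he) hw

lemma exists_coe_mul_eq_smul (he : IsSplitPrimitive ℂ e) (hz : z ∈ gradedCentralizer 𝒜 r)
    (hw : w ∈ gradedCentralizer 𝒜 (-r)) : ∃ c : ℂ, (e : A) * (z * w) = c • (e : A) := by
  have hzw : z * w ∈ gradedCentralizer 𝒜 0 := by
    simpa using mul_mem_gradedCentralizer hz hw
  obtain ⟨c, hc⟩ := he.exists_mul_eq_smul _ (mem_center_of_mem_gradedCentralizer_zero hzw)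
  exact ⟨c, congrArg Subtype.val hc⟩

end GradedCentralizer

section Pairing

variable {m : ℕ} {A : Type u} [Ring A] [Algebra ℂ A] {𝒜 : ZMod m → Submodule ℂ A}
  [GradedAlgebra 𝒜] (lam₀ : zeroPart 𝒜 →ₗ[ℂ] ℂ)

lemma extendByZero_coe (a : zeroPart 𝒜) :
    extendByZero 𝒜 lam₀ (a : A) = lam₀ a := by
  rw [extendByZero, LinearMap.comp_apply]
  exact congrArg lam₀ (Subtype.ext (DirectSum.decompose_of_mem_same 𝒜 a.2))

/-- The pairing `(x, w) ↦ lam (x w)` between the components of degrees `r` and `-r`. -/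
def pairing (r : ZMod m) : 𝒜 r →ₗ[ℂ] 𝒜 (-r) →ₗ[ℂ] ℂ :=
  ((LinearMap.mul ℂ A).compr₂ (extendByZero 𝒜 lam₀)).domRestrict₁₂ (𝒜 r) (𝒜 (-r))

lemma pairing_apply {r : ZMod m} (x : 𝒜 r) (w : 𝒜 (-r)) :
    pairing lam₀ r x w = extendByZero 𝒜 lam₀ ((x : A) * (w : A)) := rfl

end Pairing

namespace IsGradedFrobeniusStar

variable {m : ℕ} {A : Type u} [Ring A] [Algebra ℂ A] [FiniteDimensional ℂ A] [StarRing A]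
  [StarModule ℂ A] {𝒜 : ZMod m → Submodule ℂ A} [GradedAlgebra 𝒜] {lam₀ : zeroPart 𝒜 →ₗ[ℂ] ℂ}
  (hA : IsGradedFrobeniusStar 𝒜 lam₀)

section Star

include hA

lemma eq_zero_of_extendByZero_mul_star {a : A} (h : extendByZero 𝒜 lam₀ (a * star a) = 0) :
    a = 0 := by
  by_contra ha
  simpa [h] using hA.pos_def a ha

lemma eq_zero_of_mul_star {a : A} (h : a * star a = 0) : a = 0 :=
  hA.eq_zero_of_extendByZero_mul_star (by rw [h, map_zero])

lemma star_mem_zero {a : A} (ha : a ∈ 𝒜 0) : star a ∈ 𝒜 0 := by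
  simpa using hA.star_mem 0 a ha

lemma star_mem_of_neg {r : ZMod m} {a : A} (ha : a ∈ 𝒜 (-r)) : star a ∈ 𝒜 r := by
  simpa using hA.star_mem (-r) a ha

lemma isSemisimpleRing_zeroPart : IsSemisimpleRing (zeroPart 𝒜) := by
  let B : StarSubalgebra ℂ A := { zeroPart 𝒜 with star_mem' := hA.star_mem_zero }
  let : StarRing (zeroPart 𝒜) := inferInstanceAs (StarRing B)
  have := IsArtinianRing.of_finite ℂ (zeroPart 𝒜)
  exact isSemisimpleRing_of_mul_star_eq_zero fun a ha =>
    Subtype.ext (hA.eq_zero_of_mul_star (congrArg Subtype.val ha))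

lemma star_mem_gradedCentralizer {r : ZMod m} {w : A} (hw : w ∈ gradedCentralizer 𝒜 r) :
    star w ∈ gradedCentralizer 𝒜 (-r) := by
  rw [mem_gradedCentralizer_iff] at hw ⊢
  refine ⟨hA.star_mem _ _ hw.1, fun a ha => ?_⟩
  simpa using (congrArg star (hw.2 (star a) (hA.star_mem_zero ha))).symm

end Star

section Pairing

include hA

lemma extendByZero_mul_comm {a b : A} (ha : a ∈ 𝒜 0) (hb : b ∈ 𝒜 0) :
    extendByZero 𝒜 lam₀ (a * b) = extendByZero 𝒜 lam₀ (b * a) := by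
  have h := hA.class_functional ⟨a, ha⟩ ⟨b, hb⟩
  rwa [← extendByZero_coe, ← extendByZero_coe] at h

include hA

lemma isPerfPair_pairing (r : ZMod m) : (pairing lam₀ r).IsPerfPair := by
  apply LinearMap.IsPerfPair.of_injective
  · refine (injective_iff_map_eq_zero _).2 fun x hx => Subtype.ext ?_
    exact hA.eq_zero_of_extendByZero_mul_star
      (LinearMap.congr_fun hx ⟨star (x : A), hA.star_mem r _ x.2⟩)
  · refine (injective_iff_map_eq_zero _).2 fun w hw => Subtype.ext (star_eq_zero.1 ?_)
    apply hA.eq_zero_of_extendByZero_mul_star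
    rw [star_star]
    exact LinearMap.congr_fun hw ⟨star (w : A), hA.star_mem_of_neg w.2⟩

lemma flip_pairing_mem_iff {r : ZMod m} (w : 𝒜 (-r)) :
    (pairing lam₀ r).flip w ∈ twistedClassFunctionals 𝒜 r ↔
      (w : A) ∈ gradedCentralizer 𝒜 (-r) := by
  have hleft (a : zeroPart 𝒜) (x : 𝒜 r) :
      (pairing lam₀ r).flip w ⟨a * x, zeroPart_mul_mem 𝒜 a x⟩ =
        (pairing lam₀ r).flip ⟨w * a, mul_zeroPart_mem 𝒜 w a⟩ x := by
    have hxw : (x : A) * (w : A) ∈ 𝒜 0 := by simpa using SetLike.mul_mem_graded x.2 w.2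
    simp only [LinearMap.flip_apply, pairing_apply, mul_assoc]
    rw [hA.extendByZero_mul_comm a.2 hxw, mul_assoc]
  have hright (a : zeroPart 𝒜) (x : 𝒜 r) :
      (pairing lam₀ r).flip w ⟨x * a, mul_zeroPart_mem 𝒜 x a⟩ =
        (pairing lam₀ r).flip ⟨a * w, zeroPart_mul_mem 𝒜 a w⟩ x := by
    simp only [LinearMap.flip_apply, pairing_apply, mul_assoc]
  rw [mem_gradedCentralizer_iff]
  constructor
  · intro h
    refine ⟨w.2, fun a ha => ?_⟩
    have hflip : (pairing lam₀ r).flip ⟨a * w, zeroPart_mul_mem 𝒜 ⟨a, ha⟩ w⟩ =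
        (pairing lam₀ r).flip ⟨w * a, mul_zeroPart_mem 𝒜 w ⟨a, ha⟩⟩ :=
      LinearMap.ext fun x =>
        (hright ⟨a, ha⟩ x).symm.trans ((h ⟨a, ha⟩ x).symm.trans (hleft ⟨a, ha⟩ x))
    exact congrArg Subtype.val ((hA.isPerfPair_pairing r).bijective_right.injective hflip)
  · intro h a x
    rw [hleft, hright]
    congr 2
    exact Subtype.ext (h.2 a a.2).symm

lemma finrank_twistedClassFunctionals (r : ZMod m) :
    Module.finrank ℂ (twistedClassFunctionals 𝒜 r) =
      Module.finrank ℂ (gradedCentralizer 𝒜 (-r)) := by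
  let f : 𝒜 (-r) ≃ₗ[ℂ] Module.Dual ℂ (𝒜 r) :=
    .ofBijective _ (hA.isPerfPair_pairing r).bijective_right
  have hcomap : (twistedClassFunctionals 𝒜 r).comap f.toLinearMap =
      (gradedCentralizer 𝒜 (-r)).comap (𝒜 (-r)).subtype :=
    Submodule.ext hA.flip_pairing_mem_iff
  have hle : gradedCentralizer 𝒜 (-r) ≤ 𝒜 (-r) := inf_le_left
  rw [← (Submodule.comapSubtypeEquivOfLe hle).finrank_eq, ← hcomap,
    (Submodule.comap_equiv_eq_map_symm f (twistedClassFunctionals 𝒜 r) :)]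
  exact (LinearEquiv.finrank_map_eq f.symm _).symm

end Pairing

section Stabilizer

variable {e : zeroPart 𝒜} {r : ZMod m}

include hA

lemma exists_coe_mul_eq_self (he : IsSplitPrimitive ℂ e) {w : A}
    (hw : w ∈ gradedCentralizer 𝒜 r) (hew : (e : A) * w ≠ 0) :
    ∃ u ∈ gradedCentralizer 𝒜 (-r), (e : A) * (w * u) = e ∧ (e : A) * (u * w) = e := by
  have hstar := hA.star_mem_gradedCentralizer hw
  have hcomm := coe_mul_comm_of_mem_gradedCentralizer hw e
  obtain ⟨c, hc⟩ := exists_coe_mul_eq_smul he hw hstar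
  obtain ⟨d, hd⟩ := exists_coe_mul_eq_smul he hstar (r := -r) (by rwa [neg_neg])
  have hc0 : c ≠ 0 := by
    rintro rfl
    refine hew (hA.eq_zero_of_mul_star ?_)
    rw [star_mul, mul_assoc, ← mul_assoc w, ← mul_assoc, hc, zero_smul, zero_mul]
  have hcd : c = d := by
    refine smul_left_injective ℂ hew ?_
    change c • ((e : A) * w) = d • ((e : A) * w)
    rw [← smul_mul_assoc, ← hc, mul_assoc, mul_assoc, ← mul_assoc, hcomm, mul_assoc, hd,
      mul_smul_comm]
  refine ⟨c⁻¹ • star w, Submodule.smul_mem _ _ hstar, ?_, ?_⟩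
  · rw [mul_smul_comm, mul_smul_comm, hc, inv_smul_smul₀ hc0]
  · rw [smul_mul_assoc, mul_smul_comm, hd, ← hcd, inv_smul_smul₀ hc0]

lemma exists_smul_eq_coe_mul (he : IsSplitPrimitive ℂ e) {w z : A}
    (hw : w ∈ gradedCentralizer 𝒜 r) (hew : (e : A) * w ≠ 0) (hz : z ∈ gradedCentralizer 𝒜 r) :
    ∃ c : ℂ, c • ((e : A) * w) = (e : A) * z := by
  obtain ⟨u, hu, hwu, -⟩ := hA.exists_coe_mul_eq_self he hw hew
  obtain ⟨c, hc⟩ := exists_coe_mul_eq_smul he hu (r := -r) (by rwa [neg_neg])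
  have hcomm := coe_mul_comm_of_mem_gradedCentralizer hw e
  refine ⟨c, ?_⟩
  calc c • ((e : A) * w) = w * ((e : A) * (u * z)) := by rw [hc, mul_smul_comm, hcomm]
    _ = (e : A) * (w * u) * z := by simp only [← mul_assoc, hcomm]
    _ = (e : A) * z := by rw [hwu]

/-- The degrees in which some element of the graded centralizer is not killed by `e`; they form a
subgroup, the stabilizer of the simple `A₀`-module belonging to `e`. -/
def stabilizer (he : IsSplitPrimitive ℂ e) : AddSubgroup (ZMod m) where
  carrier := {r | ∃ w ∈ gradedCentralizer 𝒜 r, (e : A) * w ≠ 0}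
  zero_mem' :=
    ⟨1, coe_mem_gradedCentralizer_zero (e := 1) (one_mem _), by simpa using he.ne_zero⟩
  add_mem' := by
    rintro r s ⟨w, hw, hew⟩ ⟨v, hv, hev⟩
    refine ⟨w * v, mul_mem_gradedCentralizer hw hv, fun h => hev ?_⟩
    obtain ⟨u, hu, -, huw⟩ := hA.exists_coe_mul_eq_self he hw hew
    have hcomm := coe_mul_comm_of_mem_gradedCentralizer hu e
    calc (e : A) * v = (e : A) * (u * w) * v := by rw [huw]
      _ = u * ((e : A) * (w * v)) := by simp only [← mul_assoc, hcomm]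
      _ = 0 := by rw [h, mul_zero]
  neg_mem' := by
    rintro r ⟨w, hw, hew⟩
    obtain ⟨u, hu, hwu, -⟩ := hA.exists_coe_mul_eq_self he hw hew
    refine ⟨u, hu, fun h => he.ne_zero (Subtype.ext ?_)⟩
    have hcomm := coe_mul_comm_of_mem_gradedCentralizer hw e
    rw [← hwu, ← mul_assoc, hcomm, mul_assoc, h, mul_zero, ZeroMemClass.coe_zero]

lemma mem_stabilizer_iff (he : IsSplitPrimitive ℂ e) :
    r ∈ hA.stabilizer he ↔ ∃ w ∈ gradedCentralizer 𝒜 r, (e : A) * w ≠ 0 :=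
  Iff.rfl

lemma finrank_gradedCentralizer {ι : Type*} [Fintype ι] {e : ι → zeroPart 𝒜}
    (he : ∀ i, IsSplitPrimitive ℂ (e i)) (hcomplete : CompleteOrthogonalIdempotents e)
    (r : ZMod m) :
    Module.finrank ℂ (gradedCentralizer 𝒜 r) = {i | r ∈ hA.stabilizer (he i)}.ncard := by
  let P (i : ι) : Module.End ℂ (gradedCentralizer 𝒜 r) :=
    (LinearMap.mulLeft ℂ (e i : A)).restrict fun _ =>
      coe_mul_mem_gradedCentralizer (he i).mem_center
  have hPcoe (i : ι) (w : gradedCentralizer 𝒜 r) : (P i w : A) = (e i : A) * w := rfl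
  have hP0 (i : ι) : P i ≠ 0 ↔ r ∈ hA.stabilizer (he i) := by
    rw [mem_stabilizer_iff, ne_eq, LinearMap.ext_iff, not_forall]
    simp only [Subtype.ext_iff, hPcoe, LinearMap.zero_apply, ZeroMemClass.coe_zero, Subtype.exists,
      exists_prop, ne_eq]
  have hP : CompleteOrthogonalIdempotents P := by
    refine ⟨⟨fun i => ?_, fun i j hij => ?_⟩, ?_⟩
    · ext w
      simp only [Module.End.mul_apply, hPcoe, ← mul_assoc, ← MulMemClass.coe_mul,
        (he i).isIdempotentElem.eq]
    · ext w
      simp [hPcoe, ← mul_assoc, ← MulMemClass.coe_mul, hcomplete.ortho hij]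
    · ext w
      rw [LinearMap.sum_apply, AddSubmonoidClass.coe_finsetSum]
      simp only [hPcoe, ← Finset.sum_mul, ← AddSubmonoidClass.coe_finsetSum, hcomplete.complete,
        OneMemClass.coe_one, one_mul, Module.End.one_apply]
  have hrank (i : ι) : Module.finrank ℂ (LinearMap.range (P i)) ≤ 1 := by
    by_cases h : r ∈ hA.stabilizer (he i)
    · obtain ⟨w, hw, hew⟩ := h
      refine finrank_le_one ⟨P i ⟨w, hw⟩, LinearMap.mem_range_self _ _⟩ ?_
      rintro ⟨_, z, rfl⟩
      obtain ⟨c, hc⟩ := hA.exists_smul_eq_coe_mul (he i) hw hew z.2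
      exact ⟨c, Subtype.ext (Subtype.ext hc)⟩
    · rw [not_not.1 (mt (hP0 i).1 h), LinearMap.range_zero, finrank_bot]
      exact zero_le_one
  simp only [finrank_eq_ncard_of_completeOrthogonalIdempotents hP hrank, hP0]

end Stabilizer

end IsGradedFrobeniusStar

section KernelCore

variable {R N P : Type*} [Ring R] [AddCommGroup N] [Module R N] [AddCommGroup P]

variable (R) in
/-- The largest `R`-submodule on which the additive map `φ` vanishes. -/
def kernelCore (φ : N →+ P) : Submodule R N where
  carrier := {x | ∀ r : R, φ (r • x) = 0}
  add_mem' hx hy r := by rw [smul_add, map_add, hx, hy, add_zero]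
  zero_mem' r := by rw [smul_zero, map_zero]
  smul_mem' c x hx r := by rw [← mul_smul]; exact hx _

lemma le_kernelCore_iff {φ : N →+ P} {U : Submodule R N} :
    U ≤ kernelCore R φ ↔ ∀ x ∈ U, φ x = 0 :=
  ⟨fun h x hx => by simpa using h hx 1, fun h _ hx r => h _ (U.smul_mem r hx)⟩

end KernelCore

section InducedModule

variable {m : ℕ} {A : Type u} [Ring A] [Algebra ℂ A] (𝒜 : ZMod m → Submodule ℂ A)
  [GradedAlgebra 𝒜]

lemma projZero_mul_coe (a : A) (b : zeroPart 𝒜) : projZero 𝒜 (a * b) = projZero 𝒜 a * b :=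
  Subtype.ext (DirectSum.coe_decompose_mul_of_right_mem_zero 𝒜 b.2)

lemma projZero_coe_mul (b : zeroPart 𝒜) (a : A) : projZero 𝒜 (b * a) = b * projZero 𝒜 a :=
  Subtype.ext (DirectSum.coe_decompose_mul_of_left_mem_zero 𝒜 b.2)

lemma projZero_coe (b : zeroPart 𝒜) : projZero 𝒜 (b : A) = b :=
  Subtype.ext (DirectSum.decompose_of_mem_same 𝒜 b.2)

lemma projZero_eq_zero {r : ZMod m} (hr : r ≠ 0) {a : A} (ha : a ∈ 𝒜 r) : projZero 𝒜 a = 0 :=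
  Subtype.ext (DirectSum.decompose_of_mem_ne 𝒜 ha hr)

variable (M : Type v) [AddCommGroup M] [Module (zeroPart 𝒜) M]

/-- The additive map `A ⊗_ℤ M → M`, `a ⊗ x ↦ a₀ x`, with `a₀` the degree-zero part of `a`. -/
def tensorProj : A ⊗[ℤ] M →+ M :=
  TensorProduct.liftAddHom
    ((smulAddHom (zeroPart 𝒜) M).comp (projZero 𝒜).toAddMonoidHom)
    fun n a x => by rw [map_zsmul, map_zsmul, AddMonoidHom.smul_apply]

lemma tensorProj_tmul (a : A) (x : M) : tensorProj 𝒜 M (a ⊗ₜ[ℤ] x) = projZero 𝒜 a • x := rfl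

lemma tensorProj_coe_smul (b : zeroPart 𝒜) (t : A ⊗[ℤ] M) :
    tensorProj 𝒜 M ((b : A) • t) = b • tensorProj 𝒜 M t := by
  induction t with
  | zero => simp
  | tmul a x =>
    rw [TensorProduct.smul_tmul', smul_eq_mul, tensorProj_tmul, tensorProj_tmul, projZero_coe_mul,
      mul_smul]
  | add s t hs ht => rw [smul_add, map_add, hs, ht, map_add, smul_add]

lemma balancingRelations_le_kernelCore :
    balancingRelations 𝒜 M ≤ kernelCore A (tensorProj 𝒜 M) := by
  refine Submodule.span_le.2 ?_
  rintro _ ⟨a, b, x, rfl⟩ c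
  rw [smul_sub, TensorProduct.smul_tmul', TensorProduct.smul_tmul', map_sub, tensorProj_tmul,
    tensorProj_tmul, smul_eq_mul, smul_eq_mul, ← mul_assoc, projZero_mul_coe, mul_smul, sub_self]

/-- The `A₀`-linear map `A ⊗_{A₀} M → M`, `a ⊗ x ↦ a₀ x`, with `a₀` the degree-zero part of `a`. -/
def tensorIndProj : TensorInd 𝒜 M →ₗ[zeroPart 𝒜] M where
  toFun := QuotientAddGroup.lift (balancingRelations 𝒜 M).toAddSubgroup (tensorProj 𝒜 M)
    (le_kernelCore_iff.1 (balancingRelations_le_kernelCore 𝒜 M))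
  map_add' := map_add _
  map_smul' b t := by
    obtain ⟨t, rfl⟩ := Submodule.mkQ_surjective _ t
    exact tensorProj_coe_smul 𝒜 M b t

lemma tensorComponent_le_ker_tensorIndProj {r : ZMod m} (hr : r ≠ 0) :
    tensorComponent 𝒜 M r ≤ LinearMap.ker (tensorIndProj 𝒜 M) := by
  refine Submodule.span_le.2 ?_
  rintro _ ⟨a, x, rfl⟩
  change projZero 𝒜 (a : A) • x = 0
  rw [projZero_eq_zero 𝒜 hr a.2, zero_smul]

lemma nullSocle_le_kernelCore :
    nullSocle 𝒜 M ≤ kernelCore A (tensorIndProj 𝒜 M).toAddMonoidHom := by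
  refine sSup_le fun U ⟨hgraded, hnull⟩ => le_kernelCore_iff.2 ?_
  suffices h : U.restrictScalars (zeroPart 𝒜) ≤ LinearMap.ker (tensorIndProj 𝒜 M) from h
  rw [hgraded]
  refine iSup_le fun r => ?_
  rcases eq_or_ne r 0 with rfl | hr
  · exact hnull.trans_le bot_le
  · exact inf_le_right.trans (tensorComponent_le_ker_tensorIndProj 𝒜 M hr)

variable {M}

/-- The class of `a ⊗ x` in the induced module. -/
def inducedMk (a : A) (x : M) : Induced 𝒜 M :=
  (nullSocle 𝒜 M).mkQ ((balancingRelations 𝒜 M).mkQ (a ⊗ₜ[ℤ] x))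

lemma inducedMk_add (a : A) (x y : M) :
    inducedMk 𝒜 a (x + y) = inducedMk 𝒜 a x + inducedMk 𝒜 a y := by
  simp only [inducedMk, TensorProduct.tmul_add, map_add]

lemma inducedMk_zero_left (x : M) : inducedMk 𝒜 0 x = 0 := by
  simp only [inducedMk, TensorProduct.zero_tmul, map_zero]

lemma coe_smul_inducedMk (b : zeroPart 𝒜) (a : A) (x : M) :
    b • inducedMk 𝒜 a x = inducedMk 𝒜 (b * a) x := rfl

lemma inducedMk_mul_coe (a : A) (b : zeroPart 𝒜) (x : M) :
    inducedMk 𝒜 (a * b) x = inducedMk 𝒜 a (b • x) := by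
  refine congrArg (nullSocle 𝒜 M).mkQ ((Submodule.Quotient.eq _).2 ?_)
  exact Submodule.subset_span ⟨a, b, x, rfl⟩

lemma projZero_mul_smul_eq_zero {a : A} {x : M} (h : inducedMk 𝒜 a x = 0) (b : A) :
    projZero 𝒜 (b * a) • x = 0 :=
  nullSocle_le_kernelCore 𝒜 M ((Submodule.Quotient.mk_eq_zero _).1 h) b

lemma conjugate_eq_span (r : ZMod m) :
    conjugate 𝒜 M r = Submodule.span (zeroPart 𝒜) {t | ∃ a ∈ 𝒜 r, ∃ x : M,
      t = inducedMk 𝒜 a x} := by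
  rw [conjugate, tensorComponent, Submodule.map_span]
  congr 1
  ext t
  constructor
  · rintro ⟨_, ⟨a, x, rfl⟩, rfl⟩
    exact ⟨a, a.2, x, rfl⟩
  · rintro ⟨a, ha, x, rfl⟩
    exact ⟨_, ⟨⟨a, ha⟩, x, rfl⟩, rfl⟩

variable {𝒜} {r : ZMod m} {e : zeroPart 𝒜}

lemma nonempty_conjugate_equiv (he : ∀ x : M, e • x = x) {w u : A}
    (hw : w ∈ gradedCentralizer 𝒜 r) (hu : u ∈ gradedCentralizer 𝒜 (-r))
    (huw : (e : A) * (u * w) = e) : Nonempty (conjugate 𝒜 M r ≃ₗ[zeroPart 𝒜] M) := by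
  have hwcomm := coe_mul_comm_of_mem_gradedCentralizer hw
  have hucomm := coe_mul_comm_of_mem_gradedCentralizer hu
  let f : M →ₗ[zeroPart 𝒜] Induced 𝒜 M :=
    { toFun := inducedMk 𝒜 w
      map_add' := inducedMk_add 𝒜 w
      map_smul' := fun b x => by
        rw [RingHom.id_apply, coe_smul_inducedMk, hwcomm, inducedMk_mul_coe] }
  have hinj : Function.Injective f := by
    refine (injective_iff_map_eq_zero f).2 fun x hx => ?_
    have h := projZero_mul_smul_eq_zero 𝒜 hx (e * u)
    rwa [mul_assoc, huw, projZero_coe, he] at h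
  have hrange : LinearMap.range f = conjugate 𝒜 M r := by
    rw [conjugate_eq_span]
    apply le_antisymm
    · rintro _ ⟨x, rfl⟩
      exact Submodule.subset_span ⟨w, hw.1, x, rfl⟩
    · refine Submodule.span_le.2 ?_
      rintro _ ⟨a, ha, x, rfl⟩
      have hau : a * u ∈ 𝒜 0 := by simpa using SetLike.mul_mem_graded ha hu.1
      refine ⟨(⟨a * u, hau⟩ : zeroPart 𝒜) • e • x, ?_⟩
      calc inducedMk 𝒜 w ((⟨a * u, hau⟩ : zeroPart 𝒜) • e • x)
          = inducedMk 𝒜 (a * u * w * e) x := by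
            rw [← inducedMk_mul_coe, ← hwcomm, inducedMk_mul_coe]
        _ = inducedMk 𝒜 (a * ((e : A) * (u * w))) x := by
            rw [← mul_assoc (e : A), hucomm, mul_assoc u, hwcomm, mul_assoc, mul_assoc]
        _ = inducedMk 𝒜 a x := by rw [huw, inducedMk_mul_coe, he]
  exact ⟨((LinearEquiv.ofInjective f hinj).trans (.ofEq _ _ hrange)).symm⟩

lemma smul_eq_zero_of_mem_conjugate (hcenter : e ∈ Subalgebra.center ℂ (zeroPart 𝒜))
    (he : ∀ x : M, e • x = x) (h : ∀ a ∈ 𝒜 r, (e : A) * a * e = 0) {t : Induced 𝒜 M}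
    (ht : t ∈ conjugate 𝒜 M r) : e • t = 0 := by
  rw [conjugate_eq_span] at ht
  induction ht using Submodule.span_induction with
  | mem t ht =>
    obtain ⟨a, ha, x, rfl⟩ := ht
    rw [coe_smul_inducedMk, ← he x, ← inducedMk_mul_coe, h a ha, inducedMk_zero_left]
  | zero => exact smul_zero _
  | add s t _ _ hs ht => rw [smul_add, hs, ht, add_zero]
  | smul b t _ ht =>
    rw [smul_smul, ← Subalgebra.mem_center_iff.1 hcenter, mul_smul, ht, smul_zero]

lemma exists_mul_mul_ne_zero [Nontrivial M] (hcenter : e ∈ Subalgebra.center ℂ (zeroPart 𝒜))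
    (he : ∀ x : M, e • x = x) (f : conjugate 𝒜 M r ≃ₗ[zeroPart 𝒜] M) :
    ∃ a ∈ 𝒜 r, (e : A) * a * e ≠ 0 := by
  by_contra! h
  obtain ⟨x, hx⟩ := exists_ne (0 : M)
  have hzero : e • f.symm x = 0 :=
    Subtype.ext (smul_eq_zero_of_mem_conjugate hcenter he h (f.symm x).2)
  rw [← map_smul, he, map_eq_zero_iff _ f.symm.injective] at hzero
  exact hx hzero

end InducedModule

section Conjugate

variable {m : ℕ} {A : Type u} [Ring A] [Algebra ℂ A] {𝒜 : ZMod m → Submodule ℂ A}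
  [GradedAlgebra 𝒜] {ι : Type*} [DecidableEq ι] {n : ι → Type*} [∀ i, Fintype (n i)]
  [∀ i, DecidableEq (n i)] (f : zeroPart 𝒜 ≃ₐ[ℂ] ∀ i, Matrix (n i) (n i) ℂ) {i : ι} {r : ZMod m}

lemma blockAverage_mem_gradedCentralizer (p q : n i) {a : A} (ha : a ∈ 𝒜 r) :
    blockAverage f i p q a ∈ gradedCentralizer 𝒜 r := by
  refine mem_gradedCentralizer_iff.2
    ⟨Submodule.sum_mem _ fun k _ => ?_, fun b hb => mul_blockAverage_comm f i p q a ⟨b, hb⟩⟩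
  exact mul_zeroPart_mem 𝒜 ⟨_, zeroPart_mul_mem 𝒜 (blockUnit f i k p) ⟨a, ha⟩⟩ (blockUnit f i q k)

variable [∀ i, Nonempty (n i)] [FiniteDimensional ℂ A] [StarRing A] [StarModule ℂ A]
  {lam₀ : zeroPart 𝒜 →ₗ[ℂ] ℂ}

lemma IsGradedFrobeniusStar.nonempty_conjugate_equiv_iff (hA : IsGradedFrobeniusStar 𝒜 lam₀)
    {M : Type v} [AddCommGroup M] [Module (zeroPart 𝒜) M] [Nontrivial M]
    (hM : ∀ x : M, blockIdempotent f i • x = x) :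
    Nonempty (conjugate 𝒜 M r ≃ₗ[zeroPart 𝒜] M) ↔
      r ∈ hA.stabilizer (isSplitPrimitive_blockIdempotent f i) := by
  have he := isSplitPrimitive_blockIdempotent f i
  constructor
  · rintro ⟨g⟩
    obtain ⟨a, ha, hea⟩ := exists_mul_mul_ne_zero he.mem_center hM g
    obtain ⟨p, q, hpq⟩ := exists_mul_blockAverage_ne_zero f hea
    exact ⟨_, blockAverage_mem_gradedCentralizer f p q ha, hpq⟩
  · rintro ⟨w, hw, hew⟩
    obtain ⟨u, hu, -, huw⟩ := hA.exists_coe_mul_eq_self he hw hew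
    exact nonempty_conjugate_equiv hM hw hu huw

end Conjugate

section FixedSim

variable {m : ℕ} {A : Type u} [Ring A] [Algebra ℂ A] (𝒜 : ZMod m → Submodule ℂ A)
  [GradedAlgebra 𝒜]

/-- `Sim(A₀)^H`: the classes of the simple `A₀`-modules `M` with `M^s ≅ M` for all `s` in the
subgroup `H` of `ℤ/m`. -/
def fixedSim (H : AddSubgroup (ZMod m)) : Set (Sim (zeroPart 𝒜)) :=
  {c | ∃ M : {M : ModuleCat.{u} (zeroPart 𝒜) // IsSimpleModule (zeroPart 𝒜) M},
    Quotient.mk (simpleSetoid (zeroPart 𝒜)) M = c ∧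
      ∀ s ∈ H, Nonempty (conjugate 𝒜 M.1 s ≃ₗ[zeroPart 𝒜] M.1)}

lemma invariantSim_eq_fixedSim : invariantSim 𝒜 = fixedSim 𝒜 (AddSubgroup.zmultiples 1) := by
  have htop : AddSubgroup.zmultiples (1 : ZMod m) = ⊤ := by
    refine eq_top_iff.2 fun s _ => ?_
    obtain ⟨k, rfl⟩ := ZMod.intCast_surjective s
    exact ⟨k, by simp⟩
  simp only [invariantSim, fixedSim, IsInvariant, htop, AddSubgroup.mem_top, true_imp_iff]

variable {𝒜} {ι : Type*} [DecidableEq ι] {n : ι → Type*} [∀ i, Fintype (n i)]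
  [∀ i, DecidableEq (n i)] [∀ i, Nonempty (n i)]
  (f : zeroPart 𝒜 ≃ₐ[ℂ] ∀ i, Matrix (n i) (n i) ℂ)
  [FiniteDimensional ℂ A] [StarRing A] [StarModule ℂ A] {lam₀ : zeroPart 𝒜 →ₗ[ℂ] ℂ}

lemma IsGradedFrobeniusStar.mk_mem_fixedSim_iff (hA : IsGradedFrobeniusStar 𝒜 lam₀)
    (H : AddSubgroup (ZMod m)) {i : ι} {c : Sim (zeroPart 𝒜)}
    (hc : ∀ M, c = Quotient.mk (simpleSetoid (zeroPart 𝒜)) M ↔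
      ∀ x : M.1, blockIdempotent f i • x = x) :
    c ∈ fixedSim 𝒜 H ↔ H ≤ hA.stabilizer (isSplitPrimitive_blockIdempotent f i) := by
  have hiff (M) (hM : c = Quotient.mk (simpleSetoid (zeroPart 𝒜)) M) (s : ZMod m) :
      Nonempty (conjugate 𝒜 M.1 s ≃ₗ[zeroPart 𝒜] M.1) ↔
        s ∈ hA.stabilizer (isSplitPrimitive_blockIdempotent f i) :=
    have := M.2
    have := IsSimpleModule.nontrivial (zeroPart 𝒜) M.1
    hA.nonempty_conjugate_equiv_iff f ((hc M).1 hM)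
  constructor
  · rintro ⟨M, hM, hfixed⟩ s hs
    exact (hiff M hM.symm s).1 (hfixed s hs)
  · intro hle
    obtain ⟨M, hM⟩ := Quotient.exists_rep c
    exact ⟨M, hM, fun s hs => (hiff M hM.symm s).2 (hle hs)⟩

end FixedSim

end TwistedClass

end

theorem corollary4p16_general {m : ℕ} {A : Type u} [Ring A] [Algebra ℂ A]
    [FiniteDimensional ℂ A] [StarRing A] [StarModule ℂ A]
    (𝒜 : ZMod m → Submodule ℂ A) [GradedAlgebra 𝒜]
    (lam₀ : TwistedClass.zeroPart 𝒜 →ₗ[ℂ] ℂ)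
    (hA : TwistedClass.IsGradedFrobeniusStar 𝒜 lam₀) (r : ZMod m) :
    (TwistedClass.fixedSim 𝒜 (AddSubgroup.zmultiples r)).Finite ∧
      Module.finrank ℂ (TwistedClass.twistedClassFunctionals 𝒜 r) =
        (TwistedClass.fixedSim 𝒜 (AddSubgroup.zmultiples r)).ncard := by
  have := hA.isSemisimpleRing_zeroPart
  obtain ⟨n, d, _, ⟨f⟩⟩ :=
    IsSemisimpleRing.exists_algEquiv_pi_matrix_of_isAlgClosed ℂ (TwistedClass.zeroPart 𝒜)
  obtain ⟨S, hS⟩ := TwistedClass.exists_equiv_sim f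
  have he (i) := TwistedClass.isSplitPrimitive_blockIdempotent f i
  have hfixed : S ⁻¹' TwistedClass.fixedSim 𝒜 (AddSubgroup.zmultiples r) =
      {i | -r ∈ hA.stabilizer (he i)} := by
    ext i
    rw [Set.mem_preimage, hA.mk_mem_fixedSim_iff f _ (hS i), AddSubgroup.zmultiples_le]
    exact neg_mem_iff.symm
  have := Finite.of_equiv _ S
  refine ⟨Set.toFinite _, ?_⟩
  rw [hA.finrank_twistedClassFunctionals, hA.finrank_gradedCentralizer he
    (TwistedClass.completeOrthogonalIdempotents_blockIdempotent f), ← hfixed,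
    ← Set.ncard_image_of_injective _ S.injective, S.image_preimage]

theorem corollary4p16 {m : ℕ} [NeZero m] {A : Type u} [Ring A] [Algebra ℂ A]
    [FiniteDimensional ℂ A] [StarRing A] [StarModule ℂ A]
    (𝒜 : ZMod m → Submodule ℂ A) [GradedAlgebra 𝒜]
    (lam₀ : TwistedClass.zeroPart 𝒜 →ₗ[ℂ] ℂ)
    (hA : TwistedClass.IsGradedFrobeniusStar 𝒜 lam₀) :
    (TwistedClass.invariantSim 𝒜).Finite ∧
      Module.finrank ℂ (TwistedClass.twistedClassFunctionals 𝒜 1) =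
        (TwistedClass.invariantSim 𝒜).ncard := by
  rw [TwistedClass.invariantSim_eq_fixedSim]
  exact corollary4p16_general 𝒜 lam₀ hA 1
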